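/- **Setting.** Let $z_1,z_2,\dots$ be i.i.d. samples $z=(x,y)$ from a law $P$, with labels $y\in\{-1,+1\}$, and let $\ell:\mathbb R\to[0,\infty)$ be a measurable margin loss (for example the hinge, logistic or 0-1 loss). For a predictor $f$ put $R(f)=\mathbb E[\ell(yf(x))]$ and $\widehat R_k(f)=\frac1k\sum_{j\le k}\ell(y_jf(x_j))$ (with $\widehat R_0=0$). Let $\mathcal F_1\subseteq\mathcal F_2\subseteq\cdots$ be a finite or infinite hierarchy of classes of linear functions on which the loss is integrable, and put $R_i^*=\inf_{f\in\mathcal F_i}R(f)$. Let $B>0$ satisfy $R_1^*\le B$, and let $m\ge0$ and a computational budget $T>0$ be given. With a budget $\tau>0$, an algorithm $\mathcal A$ processes $n_i(\tau)$ samples for class $i$; $n_i(\tau)>0$ is a real number specified in (a) and (b) below, and the number of samples actually used is $\lfloor n_i(\tau)\rfloor$. Each class has a penalty $\gamma_i(k)$ for sample size $k$, and we write $\gamma_i(\tau)=\gamma_i(n_i(\tau))$. The output $\mathcal A(i,\tau)$ lies in $\mathcal F_i$ and satisfies $$\widehat R_{\lfloor n_i(\tau)\rfloor}(\mathcal A(i,\tau))-\inf_{f\in\mathcal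 F_i}\widehat R_{\lfloor n_i(\tau)\rfloor}(f)\le\gamma_i(\tau).$$ The constants $\kappa_1,\kappa_2>0$ are such that, for all classes $i$, all budgets $\tau>0$ and all $\epsilon>0$, $$\mathbb P\big(|\widehat R_{\lfloor n_i(\tau)\rfloor}(\mathcal A(i,\tau))-R(\mathcal A(i,\tau))|>\gamma_i(\tau)+\kappa_2\epsilon\big)\le\kappa_1e^{-4n_i(\tau)\epsilon^2},$$ and, for each fixed $f\in\mathcal F_i$, $\mathbb P\big(|\widehat R_{\lfloor n_i(\tau)\rfloor}(f)-R(f)|>\kappa_2\epsilon\big)\le\kappa_1e^{-4n_i(\tau)\epsilon^2}$. **Budgeted selection algorithm.** Let $s=\lceil\log_2(1+Bn_1(T))\rceil+2$ and $$\bar\gamma_i=2\gamma_i(T/s)+\kappa_2\sqrt{2(m+\log s)/n_i(T/s)}.$$ For $k=0,\dots,s-1$ let $j_{k+1}$ be the largest class index $j$ with $\bar\gamma_j\le2^k\bar\gamma_1$, and let $S=\{j_1,\dots,j_s\}$. Compute $f_i=\mathcal A(i,T/s)$ for $i\in S$, choose $\hat\imath\in S$ minimizing $$\widehat R_{\lfloor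 n_i(T/s)\rfloor}(f_i)+\gamma_i(T/s)+\tfrac{\kappa_2}2\sqrt{m/n_i(T/s)}+\tfrac{\kappa_2}2\sqrt{\log s/n_i(T/s)}$$ over $i\in S$, and output $f=f_{\hat\imath}$. **Claim.** In both of the following cases the total computation spent on fitting the classes in $S$ is at most $T$, and the stated inequality holds with probability at least $1-2\kappa_1e^{-m}$; the infima are over all classes of the hierarchy. (a) *Nested balls.* Let $x\in\mathbb R^d$ with $d\ge1$, $\mathbb E\|x\|_2^2\le X^2$ and $X>0$. Let $\mathcal F_i=\{x\mapsto\langle\theta,x\rangle:\|\theta\|_2\le r_i\}$ with $0<r_1<r_2<\cdots$ (and $r_i\to\infty$ if the hierarchy is infinite). Let $\gamma_i(k)=2r_iX/\sqrt k$, the bound from the Rademacher complexity of $\mathcal F_i$. Let $n>0$ be such that, for every class and every $\tau>0$, $n_i(\tau)=n\tau/d$ is the number of samples that $\mathcal A$ can process using $\tau$ units of computation. If $nT\ge d/B$ and $nT\ge d/(4r_1^2X^2)$, then $$R(f)\le\inf_i\Big\{R_i^*+\sqrt{\frac{d\log_2(16BnT/d)}{nT}}\Big(8r_iX+\sqrt8\,\kappa_2\sqrt{m+\log\log_2(16BnT/d)}\Big)\Big\}.$$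 (b) *Nested dimensions.* Let $x=(x_1,x_2,\dots)$ be a covariate vector, possibly infinite, and let $1\le d_1<d_2<\cdots$ be integers and $0<r_1\le r_2\le\cdots$. Let $\mathcal F_i=\{x\mapsto\langle\theta,x\rangle:\theta_j=0\text{ for }j>d_i,\ \|\theta\|_2\le r_i\}$ and let $\gamma_i(k)=\sqrt{d_i/k}$, the VC penalty. Let $n>0$ be such that, for every class and every $\tau>0$, $n_i(\tau)=n\tau/d_i$ is the number of samples that $\mathcal A$ can process using $\tau$ units of computation. If $nT\ge1$ and $nT\ge d_1/B$, then $$R(f)\le\inf_i\Big\{R_i^*+\sqrt{\frac{d_i\log_2(16BnT/d_1)}{nT}}\Big(4\sqrt{d_i}+\sqrt8\,\kappa_2\sqrt{m+\log\log_2(16BnT/d_1)}\Big)\Big\}.$$ -/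

import Mathlib

open MeasureTheory ProbabilityTheory

noncomputable section

namespace BudgetedSelection

/-! Throughout, a sample is a pair `z = (x, y)` of a covariate and a real label, a predictor is a
function `f : 𝒳 → ℝ`, and its loss on `z` is the margin loss `ℓ (y * f x)`. Model classes are
indexed by `i = 0, 1, 2, …` with `i < K`, where `K : ℕ∞`; so `K = ⊤` is the infinite hierarchy, and
index `0` is the smallest class. -/

/-- The risk `R(f) = E[ℓ(y f(x))]`. -/
def risk {𝒳 : Type*} [MeasurableSpace 𝒳] (ℓ : ℝ → ℝ) (P : Measure (𝒳 × ℝ)) (f : 𝒳 → ℝ) : ℝ :=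
  ∫ z, ℓ (z.2 * f z.1) ∂P

/-- The empirical risk of `f` on the first `k` samples. -/
def empRisk {𝒳 : Type*} (ℓ : ℝ → ℝ) (z : ℕ → 𝒳 × ℝ) (k : ℕ) (f : 𝒳 → ℝ) : ℝ :=
  (∑ j ∈ Finset.range k, ℓ ((z j).2 * f (z j).1)) / k

/-- The minimal risk `R* = inf_{f ∈ F} R(f)` of a class. -/
def minRisk {𝒳 : Type*} [MeasurableSpace 𝒳] (ℓ : ℝ → ℝ) (P : Measure (𝒳 × ℝ))
    (F : Set (𝒳 → ℝ)) : ℝ :=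
  ⨅ f : F, risk ℓ P f

/-- `Z` is an i.i.d. sample from the law `P` of a labelled covariate with labels in `{-1, 1}`. -/
structure IsClassificationSample {𝒳 Ω : Type*} [MeasurableSpace 𝒳] [MeasurableSpace Ω]
    (μ : Measure Ω) (P : Measure (𝒳 × ℝ)) (Z : ℕ → Ω → 𝒳 × ℝ) : Prop where
  measurable : ∀ j, Measurable (Z j)
  indep : iIndepFun Z μ
  law : ∀ j, μ.map (Z j) = P
  label : ∀ᵐ z ∂P, z.2 = 1 ∨ z.2 = -1

/-- The number of samples that can be processed with `τ` units of computation, if processing `k`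
samples takes `cost k` units. -/
def numSamples (cost : ℕ → ℝ) (τ : ℝ) : ℕ := sSup {k : ℕ | cost k ≤ τ}

/-- The amount of computation is calibrated by `ν`: with `τ` units of computation the algorithm can
process exactly the sample sizes `k ≤ ν i τ` for class `i`. The real number `ν i τ` is the sample
size of class `i` at budget `τ`, before rounding down to an integer. -/
def HasSampleSize (K : ℕ∞) (cost : ℕ → ℕ → ℝ) (ν : ℕ → ℝ → ℝ) : Prop :=
  ∀ i : ℕ, (i : ℕ∞) < K → ∀ τ : ℝ, 0 < τ → ∀ k : ℕ, cost i k ≤ τ ↔ (k : ℝ) ≤ ν i τ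

/-- For every class `i` and budget `τ`, the (random) output `A i τ` of the algorithm lies in `F i`,
and it is an empirical risk minimizer over `F i` up to the penalty of the class. Here `γ i` is the
penalty of class `i` as a function of the sample size. -/
def IsApproxERM {𝒳 Ω : Type*} (K : ℕ∞) (ℓ : ℝ → ℝ) (Z : ℕ → Ω → 𝒳 × ℝ)
    (F : ℕ → Set (𝒳 → ℝ)) (γ : ℕ → ℝ → ℝ) (ν : ℕ → ℝ → ℝ) (cost : ℕ → ℕ → ℝ)
    (A : ℕ → ℝ → Ω → 𝒳 → ℝ) : Prop :=
  ∀ i : ℕ, (i : ℕ∞) < K → ∀ τ : ℝ, 0 < τ → ∀ ω : Ω,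
    A i τ ω ∈ F i ∧
    empRisk ℓ (fun j => Z j ω) (numSamples (cost i) τ) (A i τ ω)
      - (⨅ f : F i, empRisk ℓ (fun j => Z j ω) (numSamples (cost i) τ) f) ≤ γ i (ν i τ)

/-- The concentration assumption, which defines the constants `κ₁` and `κ₂`: for every class, every
budget and every `ε > 0`, the empirical risk of the output of the algorithm deviates from its risk
by more than the penalty plus `κ₂ ε` with probability at most `κ₁ exp (-4 n_i ε²)`; and for each
fixed function of the class the same holds without the penalty. -/
def HasConcentration {𝒳 Ω : Type*} [MeasurableSpace 𝒳] [MeasurableSpace Ω] (K : ℕ∞)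
    (μ : Measure Ω) (P : Measure (𝒳 × ℝ)) (ℓ : ℝ → ℝ) (Z : ℕ → Ω → 𝒳 × ℝ)
    (F : ℕ → Set (𝒳 → ℝ)) (γ : ℕ → ℝ → ℝ) (ν : ℕ → ℝ → ℝ) (cost : ℕ → ℕ → ℝ)
    (A : ℕ → ℝ → Ω → 𝒳 → ℝ) (κ₁ κ₂ : ℝ) : Prop :=
  ∀ i : ℕ, (i : ℕ∞) < K → ∀ τ : ℝ, 0 < τ → ∀ ε : ℝ, 0 < ε →
    μ.real {ω | γ i (ν i τ) + κ₂ * ε <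
        |empRisk ℓ (fun j => Z j ω) (numSamples (cost i) τ) (A i τ ω) - risk ℓ P (A i τ ω)|}
      ≤ κ₁ * Real.exp (-4 * ν i τ * ε ^ 2) ∧
    ∀ f ∈ F i,
      μ.real {ω | κ₂ * ε <
          |empRisk ℓ (fun j => Z j ω) (numSamples (cost i) τ) f - risk ℓ P f|}
        ≤ κ₁ * Real.exp (-4 * ν i τ * ε ^ 2)

/-! ### The budgeted model selection algorithm -/

/-- The number `s = ⌈log₂ (1 + B n_1(T))⌉ + 2` of shares into which the budget is split. -/
def gridSize (B : ℝ) (ν : ℕ → ℝ → ℝ) (T : ℝ) : ℕ :=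
  ⌈Real.logb 2 (1 + B * ν 0 T)⌉₊ + 2

/-- The modified penalty
`2 γ_i(n_i(T / s)) + κ₂ √(2 (m + log s) / n_i(T / s))`. -/
def penBar (γ : ℕ → ℝ → ℝ) (ν : ℕ → ℝ → ℝ) (κ₂ m T : ℝ) (s i : ℕ) : ℝ :=
  2 * γ i (ν i (T / s)) + κ₂ * √(2 * (m + Real.log s) / ν i (T / s))

/-- The largest class whose modified penalty is at most `2 ^ k` times that of the first class. -/
def gridIndex (K : ℕ∞) (γ : ℕ → ℝ → ℝ) (ν : ℕ → ℝ → ℝ) (κ₂ m T : ℝ) (s k : ℕ) : ℕ :=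
  sSup {i : ℕ | (i : ℕ∞) < K ∧ penBar γ ν κ₂ m T s i ≤ 2 ^ k * penBar γ ν κ₂ m T s 0}

/-- The coarse grid. -/
def coarseGrid (K : ℕ∞) (γ : ℕ → ℝ → ℝ) (ν : ℕ → ℝ → ℝ) (κ₂ m B T : ℝ) : Finset ℕ :=
  (Finset.range (gridSize B ν T)).image (gridIndex K γ ν κ₂ m T (gridSize B ν T))

/-- The penalized empirical risk of class `i`, fitted with one share of the budget, where `z` is the
sample and `f i` is the function fitted in class `i`. -/
def criterion {𝒳 : Type*} (ℓ : ℝ → ℝ) (γ : ℕ → ℝ → ℝ) (ν : ℕ → ℝ → ℝ) (cost : ℕ → ℕ → ℝ)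
    (κ₂ m T : ℝ) (s : ℕ) (z : ℕ → 𝒳 × ℝ) (f : ℕ → 𝒳 → ℝ) (i : ℕ) : ℝ :=
  empRisk ℓ z (numSamples (cost i) (T / s)) (f i) + γ i (ν i (T / s))
    + κ₂ / 2 * √(m / ν i (T / s)) + κ₂ / 2 * √(Real.log s / ν i (T / s))

/-- `out` is the output of the algorithm: on every sample it is the function fitted, with one share
of the budget, in a class of the coarse grid that minimizes the criterion over the grid. -/
def IsOutput {𝒳 Ω : Type*} (K : ℕ∞) (ℓ : ℝ → ℝ) (Z : ℕ → Ω → 𝒳 × ℝ)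
    (γ : ℕ → ℝ → ℝ) (ν : ℕ → ℝ → ℝ) (cost : ℕ → ℕ → ℝ) (A : ℕ → ℝ → Ω → 𝒳 → ℝ)
    (κ₂ m B T : ℝ) (out : Ω → 𝒳 → ℝ) : Prop :=
  ∀ ω : Ω, ∃ i ∈ coarseGrid K γ ν κ₂ m B T,
    (∀ j ∈ coarseGrid K γ ν κ₂ m B T,
      criterion ℓ γ ν cost κ₂ m T (gridSize B ν T) (fun l => Z l ω)
          (fun l => A l (T / gridSize B ν T) ω) i
        ≤ criterion ℓ γ ν cost κ₂ m T (gridSize B ν T) (fun l => Z l ω)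
          (fun l => A l (T / gridSize B ν T) ω) j) ∧
    out ω = A i (T / gridSize B ν T) ω

/-- The total computation used to fit the classes of the coarse grid, one share of the budget
being available for each of them. -/
def totalCost (K : ℕ∞) (γ : ℕ → ℝ → ℝ) (ν : ℕ → ℝ → ℝ) (cost : ℕ → ℕ → ℝ)
    (κ₂ m B T : ℝ) : ℝ :=
  ∑ i ∈ coarseGrid K γ ν κ₂ m B T, cost i (numSamples (cost i) (T / gridSize B ν T))

/-! ### The two hierarchies of linear classifiers -/

/-- Linear functions `x ↦ ⟨θ, x⟩` on `ℝ^d` with `‖θ‖₂ ≤ ρ`. -/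
def ballClass (d : ℕ) (ρ : ℝ) : Set (EuclideanSpace ℝ (Fin d) → ℝ) :=
  {f | ∃ θ : EuclideanSpace ℝ (Fin d), ‖θ‖ ≤ ρ ∧ f = fun x => inner ℝ θ x}

/-- Linear functions of the first `D` coordinates of the covariate sequence `x`, with coefficient
vector of Euclidean norm at most `ρ`. (Covariates in `ℝ^p` are sequences that vanish from
coordinate `p` on.) -/
def dimClass (D : ℕ) (ρ : ℝ) : Set ((ℕ → ℝ) → ℝ) :=
  {f | ∃ θ : ℕ →₀ ℝ, (∀ j, D ≤ j → θ j = 0) ∧ √(θ.sum fun _ t => t ^ 2) ≤ ρ ∧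
    f = fun x => θ.sum fun j t => t * x j}

/-- The penalty `2 r_i X / √k` from the Rademacher complexity of the ball of radius `r_i`. -/
def rademacherPenalty (r : ℕ → ℝ) (X : ℝ) (i : ℕ) (k : ℝ) : ℝ := 2 * r i * X / √k

/-- The penalty `√(d_i / k)` from the VC dimension. -/
def vcPenalty (D : ℕ → ℕ) (i : ℕ) (k : ℝ) : ℝ := √(D i / k)

end BudgetedSelection

end

namespace BudgetedSelection

/-! ### The budget -/

/-! Write `s` for the grid size, `N_i` for the sample size at budget `T / s`, and `p_i` for
`penBar`. The proof combines a random and a deterministic estimate.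

Random part (`measureReal_exists_risk_gt_le`): the criterion of a class is its empirical risk plus
exactly the deviation allowed by the concentration assumption. Outside a bad event it bounds the
true risk from above, so minimizing it over the grid competes with any fixed functions `g i ∈ F i`,
at cost `p_i`. There are at most `s` grid classes with two bad events each; the `log s` term in the
deviation pays for the union bound.

Deterministic part (`exists_mem_coarseGrid_penBar_le` and `hgrid`): the grid is geometric in `p`, so
a class in its range lies inside a grid class with penalty at most `2 p_i`, whose minimal risk is no
larger by nesting. A class beyond the range has `p_i > 2 (1 + B ν_0(T)) p_0`. The budget conditions
give `p_0 ν_0(T) ≥ 1`, hence `p_i ≥ 2 p_0 + B`, and a grid class containing the first one already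
does better.

Both hierarchies are instances of `totalCost_le_and_measureReal_le`, and `s ≤ log₂ (16 B ν_0(T))`
yields the stated form. -/

theorem cost_numSamples_le {K : ℕ∞} {cost : ℕ → ℕ → ℝ} {ν : ℕ → ℝ → ℝ}
    (h : HasSampleSize K cost ν) {i : ℕ} (hi : (i : ℕ∞) < K) {τ : ℝ} (hτ : 0 < τ)
    (hν : 0 ≤ ν i τ) : cost i (numSamples (cost i) τ) ≤ τ := by
  have hset : {k : ℕ | cost i k ≤ τ} = {k : ℕ | (k : ℝ) ≤ ν i τ} :=
    Set.ext fun k => h i hi τ hτ k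
  -- `sSup` on `ℕ` is a maximum only for a nonempty bounded set: `0 ≤ ν i τ` puts `0` in it, and `⌊ν
  -- i τ⌋₊` bounds it.
  have hmem : sSup {k : ℕ | cost i k ≤ τ} ∈ {k : ℕ | cost i k ≤ τ} := by
    rw [hset]
    exact Nat.sSup_mem ⟨0, by simpa using hν⟩ ⟨⌊ν i τ⌋₊, fun k hk => Nat.le_floor hk⟩
  exact hmem

/-! ### The coarse grid -/

theorem two_le_gridSize (B : ℝ) (ν : ℕ → ℝ → ℝ) (T : ℝ) : 2 ≤ gridSize B ν T :=
  Nat.le_add_left _ _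

theorem card_coarseGrid_le (K : ℕ∞) (γ : ℕ → ℝ → ℝ) (ν : ℕ → ℝ → ℝ) (κ₂ m B T : ℝ) :
    (coarseGrid K γ ν κ₂ m B T).card ≤ gridSize B ν T :=
  Finset.card_image_le.trans (Finset.card_range _).le

section Grid

variable {K : ℕ∞} {γ : ℕ → ℝ → ℝ} {ν : ℕ → ℝ → ℝ} {κ₂ m B T : ℝ}

/-- Divergence of the penalties makes each `gridIndex` a true maximum instead of the default value
`0` of `sSup`, also when `K = ⊤`. -/
theorem bddAbove_penBar_le {s : ℕ}
    (ht : Filter.Tendsto (penBar γ ν κ₂ m T s) Filter.atTop Filter.atTop) (C : ℝ) :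
    BddAbove {i : ℕ | (i : ℕ∞) < K ∧ penBar γ ν κ₂ m T s i ≤ C} := by
  obtain ⟨M, hM⟩ := Filter.eventually_atTop.1 (ht.eventually_gt_atTop C)
  refine ⟨M, fun i hi => ?_⟩
  by_contra hlt
  exact (hM i (not_le.1 hlt).le).not_ge hi.2

theorem gridIndex_mem {s : ℕ} (hK : 0 < K) (h0 : 0 ≤ penBar γ ν κ₂ m T s 0)
    (ht : Filter.Tendsto (penBar γ ν κ₂ m T s) Filter.atTop Filter.atTop) (k : ℕ) :
    (gridIndex K γ ν κ₂ m T s k : ℕ∞) < K ∧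
      penBar γ ν κ₂ m T s (gridIndex K γ ν κ₂ m T s k) ≤ 2 ^ k * penBar γ ν κ₂ m T s 0 :=
  Nat.sSup_mem
    (s := {i : ℕ | (i : ℕ∞) < K ∧ penBar γ ν κ₂ m T s i ≤ 2 ^ k * penBar γ ν κ₂ m T s 0})
    ⟨0, by simpa using hK, le_mul_of_one_le_left h0 (one_le_pow₀ one_le_two)⟩
    (bddAbove_penBar_le ht _)

theorem lt_of_mem_coarseGrid (hK : 0 < K) (h0 : 0 ≤ penBar γ ν κ₂ m T (gridSize B ν T) 0)
    (ht : Filter.Tendsto (penBar γ ν κ₂ m T (gridSize B ν T)) Filter.atTop Filter.atTop)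
    {i : ℕ} (hi : i ∈ coarseGrid K γ ν κ₂ m B T) : (i : ℕ∞) < K := by
  obtain ⟨k, -, rfl⟩ := Finset.mem_image.1 hi
  exact (gridIndex_mem hK h0 ht k).1

theorem gridIndex_mem_coarseGrid {k : ℕ} (hk : k < gridSize B ν T) :
    gridIndex K γ ν κ₂ m T (gridSize B ν T) k ∈ coarseGrid K γ ν κ₂ m B T :=
  Finset.mem_image_of_mem _ (Finset.mem_range.2 hk)

/-- A class whose modified penalty is in the range of the grid is contained in a class of the grid
whose modified penalty is at most twice as large. -/
theorem exists_mem_coarseGrid_penBar_le (hK : 0 < K)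
    (h0 : 0 ≤ penBar γ ν κ₂ m T (gridSize B ν T) 0)
    (hmin : ∀ i, penBar γ ν κ₂ m T (gridSize B ν T) 0 ≤ penBar γ ν κ₂ m T (gridSize B ν T) i)
    (ht : Filter.Tendsto (penBar γ ν κ₂ m T (gridSize B ν T)) Filter.atTop Filter.atTop)
    {i : ℕ} (hi : (i : ℕ∞) < K)
    (hle : penBar γ ν κ₂ m T (gridSize B ν T) i ≤
      2 ^ (gridSize B ν T - 1) * penBar γ ν κ₂ m T (gridSize B ν T) 0) :
    ∃ j ∈ coarseGrid K γ ν κ₂ m B T, i ≤ j ∧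
      penBar γ ν κ₂ m T (gridSize B ν T) j ≤ 2 * penBar γ ν κ₂ m T (gridSize B ν T) i := by
  classical
  have hs := two_le_gridSize B ν T
  set s := gridSize B ν T with hsdef
  set p := penBar γ ν κ₂ m T s with hp
  -- The least such `k` gives the grid class: minimality means `2 ^ (k - 1) * p 0 < p i`, which is
  -- the factor 2. When `k = 0`, minimality of `p 0` is used instead.
  have hex : ∃ k, p i ≤ 2 ^ k * p 0 := ⟨_, hle⟩
  have hspec := Nat.find_spec hex
  have hfind : Nat.find hex ≤ s - 1 := Nat.find_min' hex hle
  refine ⟨_, gridIndex_mem_coarseGrid (k := Nat.find hex) (by omega),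
    le_csSup (bddAbove_penBar_le ht _) ⟨hi, hspec⟩,
    (gridIndex_mem hK h0 ht (Nat.find hex)).2.trans ?_⟩
  rcases Nat.eq_zero_or_pos (Nat.find hex) with hz | hpos
  · rw [hz, pow_zero, one_mul]
    have := hmin i
    linarith
  · have hlt := Nat.find_min hex (Nat.sub_lt hpos one_pos)
    have hpow : (2 : ℝ) ^ Nat.find hex = 2 ^ (Nat.find hex - 1) * 2 := by
      rw [← pow_succ, Nat.sub_add_cancel hpos]
    change 2 ^ Nat.find hex * p 0 ≤ 2 * p i
    rw [hpow]
    linarith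

theorem totalCost_le {cost : ℕ → ℕ → ℝ} (hT : 0 < T) (hK : 0 < K)
    (h0 : 0 ≤ penBar γ ν κ₂ m T (gridSize B ν T) 0)
    (ht : Filter.Tendsto (penBar γ ν κ₂ m T (gridSize B ν T)) Filter.atTop Filter.atTop)
    (hν : ∀ i, 0 ≤ ν i (T / gridSize B ν T)) (hc : HasSampleSize K cost ν) :
    totalCost K γ ν cost κ₂ m B T ≤ T := by
  have hs : (0 : ℝ) < gridSize B ν T := by
    exact_mod_cast zero_lt_two.trans_le (two_le_gridSize B ν T)
  calc totalCost K γ ν cost κ₂ m B T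
      ≤ ∑ _i ∈ coarseGrid K γ ν κ₂ m B T, T / gridSize B ν T :=
        Finset.sum_le_sum fun i hi => cost_numSamples_le hc (lt_of_mem_coarseGrid hK h0 ht hi)
          (div_pos hT hs) (hν i)
    _ = (coarseGrid K γ ν κ₂ m B T).card * (T / gridSize B ν T) := by
        rw [Finset.sum_const, nsmul_eq_mul]
    _ ≤ gridSize B ν T * (T / gridSize B ν T) := by
        gcongr
        exact card_coarseGrid_le ..
    _ = T := mul_div_cancel₀ T hs.ne'

/-- The largest exponent in the grid is `s - 1 = ⌈log₂ (1 + B ν_0(T))⌉ + 1`. This is how far the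
grid reaches, and it serves to discard the classes beyond it. -/
theorem two_mul_one_add_le_two_pow_gridSize (hB : 0 ≤ B * ν 0 T) :
    2 * (1 + B * ν 0 T) ≤ 2 ^ (gridSize B ν T - 1) := by
  have h1 : (0 : ℝ) < 1 + B * ν 0 T := by linarith
  have h2 : 1 + B * ν 0 T ≤ 2 ^ ⌈Real.logb 2 (1 + B * ν 0 T)⌉₊ := by
    rw [← Real.rpow_natCast, ← Real.logb_le_iff_le_rpow one_lt_two h1]
    exact Nat.le_ceil _
  rw [show gridSize B ν T - 1 = ⌈Real.logb 2 (1 + B * ν 0 T)⌉₊ + 1 from rfl, pow_succ]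
  linarith

/-- With `x = B ν_0(T) ≥ 1`, rounding up gives `s ≤ log₂ (1 + x) + 3 ≤ log₂ (2 x) + 3`. -/
theorem gridSize_le_logb (hB : 1 ≤ B * ν 0 T) :
    (gridSize B ν T : ℝ) ≤ Real.logb 2 (16 * (B * ν 0 T)) := by
  have h0 : 0 < B * ν 0 T := by linarith
  have h1 : Real.logb 2 (1 + B * ν 0 T) ≤ Real.logb 2 (2 * (B * ν 0 T)) :=
    Real.logb_le_logb_of_le one_lt_two (by linarith) (by linarith)
  have h2 : Real.logb 2 (16 * (B * ν 0 T)) = 3 + Real.logb 2 (2 * (B * ν 0 T)) := by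
    rw [show 16 * (B * ν 0 T) = 2 ^ (3 : ℝ) * (2 * (B * ν 0 T)) by norm_num; ring,
      Real.logb_mul (by positivity) (by positivity), Real.logb_rpow two_pos (by norm_num)]
  have h3 := Nat.ceil_lt_add_one (Real.logb_nonneg one_lt_two (by linarith : 1 ≤ 1 + B * ν 0 T))
  have h4 : (gridSize B ν T : ℝ) = ⌈Real.logb 2 (1 + B * ν 0 T)⌉₊ + 2 := by
    simp [gridSize]
  linarith

end Grid

/-! ### Risks -/

section Risk

variable {𝒳 : Type*} {ℓ : ℝ → ℝ}

theorem empRisk_nonneg (hℓ0 : ∀ t, 0 ≤ ℓ t) (z : ℕ → 𝒳 × ℝ) (k : ℕ) (f : 𝒳 → ℝ) :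
    0 ≤ empRisk ℓ z k f :=
  div_nonneg (Finset.sum_nonneg fun _ _ => hℓ0 _) (Nat.cast_nonneg k)

variable [MeasurableSpace 𝒳] {P : Measure (𝒳 × ℝ)}

theorem risk_nonneg (hℓ0 : ∀ t, 0 ≤ ℓ t) (f : 𝒳 → ℝ) : 0 ≤ risk ℓ P f :=
  integral_nonneg fun _ => hℓ0 _

theorem minRisk_nonneg (hℓ0 : ∀ t, 0 ≤ ℓ t) (F : Set (𝒳 → ℝ)) : 0 ≤ minRisk ℓ P F :=
  Real.iInf_nonneg fun _ => risk_nonneg hℓ0 _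

theorem minRisk_anti (hℓ0 : ∀ t, 0 ≤ ℓ t) {F G : Set (𝒳 → ℝ)} (hF : F.Nonempty) (h : F ⊆ G) :
    minRisk ℓ P G ≤ minRisk ℓ P F := by
  have := hF.to_subtype
  exact le_ciInf fun f => ciInf_le ⟨0, Set.forall_mem_range.2 fun _ => risk_nonneg hℓ0 _⟩
    (⟨f, h f.2⟩ : G)

end Risk

/-! ### The oracle inequality over the grid -/

theorem sqrt_div_add_sqrt_div_le {a b N : ℝ} (ha : 0 ≤ a) (hb : 0 ≤ b) (hN : 0 < N) :
    √(a / N) + √(b / N) ≤ √(2 * (a + b) / N) := by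
  refine Real.le_sqrt_of_sq_le ?_
  have h1 := Real.sq_sqrt (div_nonneg ha hN.le)
  have h2 := Real.sq_sqrt (div_nonneg hb hN.le)
  have h3 : 2 * (a + b) / N = 2 * (a / N) + 2 * (b / N) := by ring
  nlinarith [sq_nonneg (√(a / N) - √(b / N))]

/-- The square of a sum of nonnegative numbers dominates the sum of their squares, so the exponent
is at most `-(m + log s)`. -/
theorem mul_exp_neg_sqrt_add_sqrt_le {κ m N : ℝ} {s : ℕ} (hκ : 0 ≤ κ) (hm : 0 ≤ m) (hs : 1 ≤ s)
    (hN : 0 < N) :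
    κ * Real.exp (-4 * N * ((√(m / N) + √(Real.log s / N)) / 2) ^ 2)
      ≤ κ * Real.exp (-m) / s := by
  have hs' : (0 : ℝ) < s := by exact_mod_cast hs
  have hl : 0 ≤ Real.log s := Real.log_natCast_nonneg s
  rw [mul_div_assoc]
  refine mul_le_mul_of_nonneg_left ?_ hκ
  rw [← Real.exp_log hs', ← Real.exp_sub, Real.exp_log hs']
  refine Real.exp_le_exp.2 ?_
  have h1 := Real.sq_sqrt (div_nonneg hm hN.le)
  have h2 := Real.sq_sqrt (div_nonneg hl hN.le)
  have h3 : 0 ≤ √(m / N) * √(Real.log s / N) := by positivity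
  have h4 : N * (m / N) = m := mul_div_cancel₀ m hN.ne'
  have h5 : N * (Real.log s / N) = Real.log s := mul_div_cancel₀ _ hN.ne'
  have h6 := mul_nonneg hN.le h3
  nlinarith

/-- With high probability, the selected function is as good as any fixed choice of one function per
class of the grid, up to the modified penalties. -/
theorem measureReal_exists_risk_gt_le {𝒳 Ω : Type*} [MeasurableSpace 𝒳] [MeasurableSpace Ω]
    {μ : Measure Ω} [IsFiniteMeasure μ] {P : Measure (𝒳 × ℝ)} {K : ℕ∞} {ℓ : ℝ → ℝ}
    {Z : ℕ → Ω → 𝒳 × ℝ} {F : ℕ → Set (𝒳 → ℝ)} {γ ν : ℕ → ℝ → ℝ} {cost : ℕ → ℕ → ℝ}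
    {A : ℕ → ℝ → Ω → 𝒳 → ℝ} {κ₁ κ₂ m B T : ℝ} {out : Ω → 𝒳 → ℝ}
    (hℓ0 : ∀ t, 0 ≤ ℓ t) (hκ₁ : 0 ≤ κ₁) (hκ₂ : 0 ≤ κ₂) (hm : 0 ≤ m) (hT : 0 < T)
    (hν : ∀ i, 0 < ν i (T / gridSize B ν T))
    (hS : ∀ i ∈ coarseGrid K γ ν κ₂ m B T, (i : ℕ∞) < K)
    (hA : IsApproxERM K ℓ Z F γ ν cost A)
    (hconc : HasConcentration K μ P ℓ Z F γ ν cost A κ₁ κ₂)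
    (hout : IsOutput K ℓ Z γ ν cost A κ₂ m B T out)
    (g : ℕ → 𝒳 → ℝ) (hg : ∀ i ∈ coarseGrid K γ ν κ₂ m B T, g i ∈ F i) :
    μ.real {ω | ∃ i ∈ coarseGrid K γ ν κ₂ m B T,
        risk ℓ P (g i) + penBar γ ν κ₂ m T (gridSize B ν T) i < risk ℓ P (out ω)}
      ≤ 2 * κ₁ * Real.exp (-m) := by
  have hs := two_le_gridSize B ν T
  have hcard := card_coarseGrid_le K γ ν κ₂ m B T
  set s := gridSize B ν T with hsdef
  set S := coarseGrid K γ ν κ₂ m B T with hSdef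
  have hs0 : (0 : ℝ) < s := by exact_mod_cast zero_lt_two.trans_le hs
  have hτ : 0 < T / s := div_pos hT hs0
  have hlog : 0 < Real.log s := Real.log_pos (by exact_mod_cast hs)
  -- With this `ε`, the criterion is empirical risk `+ γ + κ₂ ε`. Since `s ≥ 2`, the term `log s`
  -- keeps `ε` positive even when `m = 0`.
  set ε : ℕ → ℝ := fun i => (√(m / ν i (T / s)) + √(Real.log s / ν i (T / s))) / 2 with hε
  have hεpos : ∀ i, 0 < ε i := fun i => by
    have : 0 < √(Real.log s / ν i (T / s)) := Real.sqrt_pos.2 (div_pos hlog (hν i))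
    have : 0 ≤ √(m / ν i (T / s)) := Real.sqrt_nonneg _
    simp only [hε]
    linarith
  set E : ℕ → Set Ω := fun i => {ω | γ i (ν i (T / s)) + κ₂ * ε i <
    |empRisk ℓ (fun j => Z j ω) (numSamples (cost i) (T / s)) (A i (T / s) ω)
      - risk ℓ P (A i (T / s) ω)|} with hE
  set E' : ℕ → Set Ω := fun i => {ω | κ₂ * ε i <
    |empRisk ℓ (fun j => Z j ω) (numSamples (cost i) (T / s)) (g i) - risk ℓ P (g i)|} with hE'
  have hb : ∀ i ∈ S, μ.real (E i ∪ E' i) ≤ 2 * (κ₁ * Real.exp (-m) / s) := fun i hi => by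
    have hexp := mul_exp_neg_sqrt_add_sqrt_le (m := m) hκ₁ hm (one_le_two.trans hs) (hν i)
    have h := hconc i (hS i hi) (T / s) hτ (ε i) (hεpos i)
    have h1 : μ.real (E i) ≤ _ := h.1.trans hexp
    have h2 : μ.real (E' i) ≤ _ := (h.2 _ (hg i hi)).trans hexp
    have := measureReal_union_le (μ := μ) (E i) (E' i)
    linarith
  have hsub : {ω | ∃ i ∈ S, risk ℓ P (g i) + penBar γ ν κ₂ m T s i < risk ℓ P (out ω)} ⊆
      ⋃ i ∈ S, (E i ∪ E' i) := by
    rintro ω ⟨i, hi, hlt⟩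
    by_contra hnot
    simp only [Set.mem_iUnion, Set.mem_union, not_exists, not_or] at hnot
    obtain ⟨k, hk, hkmin, hkout⟩ := hout ω
    simp only [hE, hE', Set.mem_ofPred_eq, not_lt] at hnot
    -- Chain for selected `k` and competitor `i`: `R(out) ≤ crit k ≤ crit i ≤ R̂(g i) + 2 γ_i + κ₂
    -- ε_i ≤ R(g i) + 2 γ_i + 2 κ₂ ε_i`, and `2 κ₂ ε_i` is at most the second term of `penBar`.
    have hEk := (abs_le.1 (hnot k hk).1).1
    have hEi := (abs_le.1 (hnot i hi).2).2
    have hcrit := hkmin i hi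
    have herm := (hA i (hS i hi) (T / s) hτ ω).2
    have hinf : (⨅ f : F i, empRisk ℓ (fun j => Z j ω) (numSamples (cost i) (T / s)) f) ≤
        empRisk ℓ (fun j => Z j ω) (numSamples (cost i) (T / s)) (g i) :=
      ciInf_le ⟨0, Set.forall_mem_range.2 fun _ => empRisk_nonneg hℓ0 _ _ _⟩
        (⟨g i, hg i hi⟩ : F i)
    have hsq := mul_le_mul_of_nonneg_left
      (sqrt_div_add_sqrt_div_le hm hlog.le (hν i)) hκ₂
    rw [hkout] at hlt
    simp only [criterion, penBar, hε] at *
    linarith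
  calc _ ≤ μ.real (⋃ i ∈ S, (E i ∪ E' i)) := measureReal_mono hsub (measure_ne_top μ _)
    _ ≤ ∑ i ∈ S, μ.real (E i ∪ E' i) := measureReal_biUnion_finset_le _ _
    _ ≤ ∑ _i ∈ S, 2 * (κ₁ * Real.exp (-m) / s) := Finset.sum_le_sum hb
    _ = S.card * (2 * (κ₁ * Real.exp (-m) / s)) := by rw [Finset.sum_const, nsmul_eq_mul]
    _ ≤ s * (2 * (κ₁ * Real.exp (-m) / s)) := by gcongr
    _ = 2 * κ₁ * Real.exp (-m) := by field_simp

/-- Continuity of the measure from below along `η = 1 / (k + 1)`. It lets near-minimizers replace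
minimizers, which need not exist. -/
theorem measureReal_lt_le_of_forall_add_lt {Ω : Type*} [MeasurableSpace Ω] {μ : Measure Ω}
    [IsFiniteMeasure μ] {R : Ω → ℝ} {M c : ℝ}
    (h : ∀ η : ℝ, 0 < η → μ.real {ω | M + η < R ω} ≤ c) : μ.real {ω | M < R ω} ≤ c := by
  have hU : {ω | M < R ω} = ⋃ k : ℕ, {ω | M + 1 / ((k : ℝ) + 1) < R ω} := by
    ext ω
    simp only [Set.mem_ofPred_eq, Set.mem_iUnion]
    constructor
    · intro hlt
      obtain ⟨k, hk⟩ := exists_nat_one_div_lt (sub_pos.2 hlt)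
      exact ⟨k, by linarith⟩
    · rintro ⟨k, hk⟩
      have : (0 : ℝ) < 1 / ((k : ℝ) + 1) := Nat.one_div_pos_of_nat
      linarith
  have hmono : Monotone fun k : ℕ => {ω | M + 1 / ((k : ℝ) + 1) < R ω} := fun k l hkl ω hω =>
    (add_le_add_right (Nat.one_div_le_one_div hkl) M).trans_lt hω
  have hlim := tendsto_measure_iUnion_atTop (μ := μ) hmono
  rw [← hU] at hlim
  exact le_of_tendsto' ((ENNReal.tendsto_toReal (measure_ne_top μ _)).comp hlim)
    fun k => h _ Nat.one_div_pos_of_nat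

/-! ### Hierarchies with linear cost and penalties of order `1 / √k` -/

section Hierarchy

variable {γ : ℕ → ℝ → ℝ} {a c : ℕ → ℝ} {n κ₂ m T : ℝ}

theorem penBar_eq (hn : 0 < n) (hT : 0 < T) (hm : 0 ≤ m) (hc : ∀ i, 0 < c i)
    (hγ : ∀ i k, 0 < k → γ i k = a i / 2 / √k) {s : ℕ} (hs : 1 ≤ s) (i : ℕ) :
    penBar γ (fun i τ => n * τ / c i) κ₂ m T s i =
      √(c i * s / (n * T)) * (a i + κ₂ * (√2 * √(m + Real.log s))) := by
  have hs' : (0 : ℝ) < s := by exact_mod_cast hs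
  have hci := hc i
  have hN : 0 < n * (T / s) / c i := by positivity
  have hinv : c i * s / (n * T) = (n * (T / s) / c i)⁻¹ := by
    field_simp
  have hl : 0 ≤ Real.log s := Real.log_natCast_nonneg s
  simp only [penBar]
  rw [hγ i _ hN, hinv, Real.sqrt_inv, Real.sqrt_div (by positivity) (n * (T / s) / c i),
    Real.sqrt_mul zero_le_two]
  ring

/-- The oracle inequality for a hierarchy in which `k` samples cost `k * c i / n` units of
computation and have penalty `a i / (2 √k)`. -/
theorem totalCost_le_and_measureReal_le {𝒳 Ω : Type*} [MeasurableSpace 𝒳] [MeasurableSpace Ω]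
    {μ : Measure Ω} [IsFiniteMeasure μ] {P : Measure (𝒳 × ℝ)} {K : ℕ∞} (hK : 0 < K) {ℓ : ℝ → ℝ}
    {Z : ℕ → Ω → 𝒳 × ℝ} {F : ℕ → Set (𝒳 → ℝ)} {cost : ℕ → ℕ → ℝ}
    {A : ℕ → ℝ → Ω → 𝒳 → ℝ} {κ₁ B : ℝ} {out : Ω → 𝒳 → ℝ}
    (hℓ0 : ∀ t, 0 ≤ ℓ t) (hκ₁ : 0 < κ₁) (hκ₂ : 0 < κ₂) (hB : 0 < B) (hn : 0 < n) (hT : 0 < T)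
    (hm : 0 ≤ m) (hc : ∀ i, 0 < c i) (hcm : Monotone c) (ha : ∀ i, 0 < a i) (ham : Monotone a)
    (hat : Filter.Tendsto a Filter.atTop Filter.atTop)
    (hγ : ∀ i k, 0 < k → γ i k = a i / 2 / √k)
    (hF : ∀ i, (F i).Nonempty) (hFm : Monotone F)
    (hmin : minRisk ℓ P (F 0) ≤ B)
    (hcost : HasSampleSize K cost (fun i τ => n * τ / c i))
    (hA : IsApproxERM K ℓ Z F γ (fun i τ => n * τ / c i) cost A)
    (hconc : HasConcentration K μ P ℓ Z F γ (fun i τ => n * τ / c i) cost A κ₁ κ₂)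
    (hnT : c 0 / B ≤ n * T) (hnT' : c 0 ≤ a 0 ^ 2 * (n * T))
    (hout : IsOutput K ℓ Z γ (fun i τ => n * τ / c i) cost A κ₂ m B T out) :
    totalCost K γ (fun i τ => n * τ / c i) cost κ₂ m B T ≤ T ∧
      μ.real {ω | ¬ risk ℓ P (out ω) ≤
          ⨅ i : {i : ℕ // (i : ℕ∞) < K},
            (minRisk ℓ P (F i) +
              √(c i * Real.logb 2 (16 * B * n * T / c 0) / (n * T)) *
                (2 * a i +
                  √8 * κ₂ * √(m + Real.log (Real.logb 2 (16 * B * n * T / c 0)))))}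
        ≤ 2 * κ₁ * Real.exp (-m) := by
  set ν : ℕ → ℝ → ℝ := fun i τ => n * τ / c i with hνdef
  have hs := two_le_gridSize B ν T
  have hc0 := hc 0
  have hBν : 1 ≤ B * ν 0 T := by
    rw [div_le_iff₀ hB] at hnT
    simp only [hνdef]
    rw [← mul_div_assoc, one_le_div hc0]
    linarith
  have hsL : (gridSize B ν T : ℝ) ≤ Real.logb 2 (16 * B * n * T / c 0) := by
    refine (gridSize_le_logb hBν).trans_eq (congrArg _ ?_)
    simp only [hνdef]
    ring
  have hpow := two_mul_one_add_le_two_pow_gridSize (zero_le_one.trans hBν)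
  have hpen := fun i => penBar_eq (κ₂ := κ₂) hn hT hm hc hγ (one_le_two.trans hs) i
  rw [← hνdef] at hpen
  set L := Real.logb 2 (16 * B * n * T / c 0) with hL
  have hs0 : (2 : ℝ) ≤ gridSize B ν T := by exact_mod_cast hs
  have hνpos : ∀ i, 0 < ν i (T / gridSize B ν T) := fun i =>
    div_pos (mul_pos hn (div_pos hT (by linarith))) (hc i)
  have hlog : 0 < Real.log (gridSize B ν T) := Real.log_pos (by linarith)
  have hnT0 : 0 < n * T := mul_pos hn hT
  set p := penBar γ ν κ₂ m T (gridSize B ν T) with hp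
  have hq : ∀ i, 0 < √(c i * gridSize B ν T / (n * T)) := fun i =>
    Real.sqrt_pos.2 (div_pos (mul_pos (hc i) (by linarith)) hnT0)
  have hqm : ∀ i, √(c 0 * gridSize B ν T / (n * T)) ≤ √(c i * gridSize B ν T / (n * T)) :=
    fun i => by
      gcongr
      exact hcm (Nat.zero_le i)
  have hsec : 0 ≤ κ₂ * (√2 * √(m + Real.log (gridSize B ν T))) := by positivity
  have hp0 : ∀ i, √(c 0 * gridSize B ν T / (n * T)) * a i ≤ p i := fun i => by
    rw [hpen i]
    exact mul_le_mul (hqm i) (by linarith) (ha i).le (hq i).le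
  have hpmin : ∀ i, p 0 ≤ p i := fun i => by
    rw [hpen i, hpen 0]
    exact mul_le_mul (hqm i) (by linarith [ham (Nat.zero_le i)]) (by linarith [ha 0]) (hq i).le
  have hp0' : 0 ≤ p 0 := (mul_pos (hq 0) (ha 0)).le.trans (hp0 0)
  have hpt : Filter.Tendsto p Filter.atTop Filter.atTop :=
    Filter.tendsto_atTop_mono hp0 (hat.const_mul_atTop (hq 0))
  refine ⟨totalCost_le hT hK hp0' hpt (fun i => (hνpos i).le) hcost, ?_⟩
  have hS : ∀ i ∈ coarseGrid K γ ν κ₂ m B T, (i : ℕ∞) < K := fun i hi =>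
    lt_of_mem_coarseGrid hK hp0' hpt hi
  have hterm : ∀ i, 2 * p i ≤ √(c i * L / (n * T)) * (2 * a i + √8 * κ₂ * √(m + Real.log L)) :=
    fun i => by
      have h8 : √8 = 2 * √2 := by
        rw [show (8 : ℝ) = 2 ^ 2 * 2 by norm_num, Real.sqrt_mul (by positivity),
          Real.sqrt_sq zero_le_two]
      have hci := (hc i).le
      have hai := (ha i).le
      calc 2 * p i = √(c i * gridSize B ν T / (n * T)) *
            (2 * a i + √8 * κ₂ * √(m + Real.log (gridSize B ν T))) := by
            rw [hpen i, h8]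
            ring
        _ ≤ _ := by gcongr
  -- This gives `p_0 ν_0(T) ≥ 1`: the square of the right side is `s * (a 0 ^ 2 * n T / c 0)`, and
  -- `hnT'` makes the bracket at least 1.
  have hq1 : 1 ≤ √(c 0 * gridSize B ν T / (n * T)) * a 0 * (n * T / c 0) := by
    have ha0 := ha 0
    have h1 : (√(c 0 * gridSize B ν T / (n * T)) * a 0 * (n * T / c 0)) ^ 2 =
        gridSize B ν T * (a 0 ^ 2 * (n * T) / c 0) := by
      rw [mul_pow, mul_pow, Real.sq_sqrt (by positivity)]
      field_simp
    have h2 : 1 ≤ a 0 ^ 2 * (n * T) / c 0 := (one_le_div hc0).2 hnT'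
    refine (one_le_sq_iff₀ (by positivity)).1 ?_
    rw [h1]
    nlinarith
  have hgrid : ∀ i : ℕ, (i : ℕ∞) < K → ∃ j ∈ coarseGrid K γ ν κ₂ m B T,
      minRisk ℓ P (F j) + p j ≤ minRisk ℓ P (F i) + 2 * p i := fun i hi => by
    rcases le_or_gt (p i) (2 ^ (gridSize B ν T - 1) * p 0) with hle | hgt
    · obtain ⟨j, hj, hij, hpj⟩ := exists_mem_coarseGrid_penBar_le hK hp0' hpmin hpt hi hle
      exact ⟨j, hj, add_le_add (minRisk_anti hℓ0 (hF i) (hFm hij)) hpj⟩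
    -- Beyond the range, compare with the grid class obtained from the first class: its minimal risk
    -- plus penalty is at most `B + 2 p_0`, which is below `p_i`.
    · obtain ⟨j, hj, -, hpj⟩ := exists_mem_coarseGrid_penBar_le (B := B) hK hp0' hpmin hpt
        (i := 0) (by simpa using hK) (le_mul_of_one_le_left hp0' (one_le_pow₀ one_le_two))
      refine ⟨j, hj, ?_⟩
      have h1 := minRisk_anti (P := P) hℓ0 (hF 0) (hFm (Nat.zero_le j))
      have h2 := minRisk_nonneg (P := P) hℓ0 (F i)
      have h3 := mul_le_mul_of_nonneg_right hpow hp0'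
      have h4 : B ≤ B * ν 0 T * p 0 := by
        have h5 : 1 ≤ p 0 * (n * T / c 0) :=
          hq1.trans (mul_le_mul_of_nonneg_right (hp0 0) (by positivity))
        calc B ≤ B * (p 0 * (n * T / c 0)) := le_mul_of_one_le_right hB.le h5
          _ = _ := by
            simp only [hνdef]
            ring
      linarith
  have hne : Nonempty {i : ℕ // (i : ℕ∞) < K} := ⟨⟨0, by simpa using hK⟩⟩
  simp only [not_le]
  refine measureReal_lt_le_of_forall_add_lt fun η hη => ?_
  -- The near-minimizers do not depend on the sample, so the concentration bound for fixed functions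
  -- applies to them.
  have hex : ∀ i, ∃ f ∈ F i, risk ℓ P f < minRisk ℓ P (F i) + η := fun i => by
    have := (hF i).to_subtype
    obtain ⟨f, hf⟩ := exists_lt_of_ciInf_lt (lt_add_of_pos_right (minRisk ℓ P (F i)) hη)
    exact ⟨f, f.2, hf⟩
  choose g hgF hg using hex
  refine (measureReal_mono fun ω hω => ?_).trans (measureReal_exists_risk_gt_le hℓ0 hκ₁.le hκ₂.le
    hm hT hνpos hS hA hconc hout g fun i _ => hgF i)
  by_contra hnot
  simp only [Set.mem_ofPred_eq, not_exists, not_and, not_lt] at hnot hω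
  refine hω.not_ge (sub_le_iff_le_add.1 (le_ciInf fun i => ?_))
  obtain ⟨j, hj, hji⟩ := hgrid i i.2
  have h1 := hnot j hj
  have h2 := hg j
  have h3 := hterm i
  linarith

end Hierarchy

/-! ### Nonemptiness and nesting of the two hierarchies -/

theorem zero_mem_ballClass (d : ℕ) {ρ : ℝ} (hρ : 0 ≤ ρ) : (fun _ => 0) ∈ ballClass d ρ :=
  ⟨0, by simpa using hρ, by simp⟩

theorem ballClass_mono (d : ℕ) : Monotone (ballClass d) := by
  rintro ρ ρ' h f ⟨θ, hθ, hf⟩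
  exact ⟨θ, hθ.trans h, hf⟩

theorem zero_mem_dimClass (D : ℕ) {ρ : ℝ} (hρ : 0 ≤ ρ) : (fun _ => 0) ∈ dimClass D ρ :=
  ⟨0, by simp, by simpa using hρ, by simp⟩

theorem dimClass_subset {D D' : ℕ} {ρ ρ' : ℝ} (hD : D ≤ D') (hρ : ρ ≤ ρ') :
    dimClass D ρ ⊆ dimClass D' ρ' := by
  rintro f ⟨θ, h0, hθ, hf⟩
  exact ⟨θ, fun j hj => h0 j (hD.trans hj), hθ.trans hρ, hf⟩

end BudgetedSelection

/-! ### The two instances -/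

open BudgetedSelection in
theorem corollary1 {Ω : Type*} [MeasurableSpace Ω] (μ : Measure Ω) [IsProbabilityMeasure μ]
    -- the number of classes, the margin loss, and the cost of fitting class `i` to `k` samples
    (K : ℕ∞) (hK : 0 < K) (ℓ : ℝ → ℝ) (hℓ : Measurable ℓ) (hℓ0 : ∀ t, 0 ≤ ℓ t)
    (cost : ℕ → ℕ → ℝ)
    (κ₁ κ₂ B n T m : ℝ) (hκ₁ : 0 < κ₁) (hκ₂ : 0 < κ₂) (hB : 0 < B) (hn : 0 < n) (hT : 0 < T)
    (hm : 0 ≤ m) :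
    -- (a) nested balls
    (∀ (d : ℕ) (r : ℕ → ℝ) (X : ℝ)
      (P : Measure (EuclideanSpace ℝ (Fin d) × ℝ))
      (Z : ℕ → Ω → EuclideanSpace ℝ (Fin d) × ℝ)
      (A : ℕ → ℝ → Ω → EuclideanSpace ℝ (Fin d) → ℝ)
      (out : Ω → EuclideanSpace ℝ (Fin d) → ℝ),
      0 < d → 0 < r 0 → StrictMono r → Filter.Tendsto r Filter.atTop Filter.atTop → 0 < X →
      IsClassificationSample μ P Z →
      Integrable (fun z => ‖z.1‖ ^ 2) P → ∫ z, ‖z.1‖ ^ 2 ∂P ≤ X ^ 2 →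
      (∀ i : ℕ, (i : ℕ∞) < K → ∀ f ∈ ballClass d (r i),
        Integrable (fun z => ℓ (z.2 * f z.1)) P) →
      minRisk ℓ P (ballClass d (r 0)) ≤ B →
      HasSampleSize K cost (fun _ τ => n * τ / d) →
      IsApproxERM K ℓ Z (fun i => ballClass d (r i)) (rademacherPenalty r X)
        (fun _ τ => n * τ / d) cost A →
      HasConcentration K μ P ℓ Z (fun i => ballClass d (r i)) (rademacherPenalty r X)
        (fun _ τ => n * τ / d) cost A κ₁ κ₂ →
      d / B ≤ n * T → d / (4 * r 0 ^ 2 * X ^ 2) ≤ n * T →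
      IsOutput K ℓ Z (rademacherPenalty r X) (fun _ τ => n * τ / d) cost A κ₂ m B T out →
      totalCost K (rademacherPenalty r X) (fun _ τ => n * τ / d) cost κ₂ m B T ≤ T ∧
      μ.real {ω | ¬ risk ℓ P (out ω) ≤
          ⨅ i : {i : ℕ // (i : ℕ∞) < K},
            (minRisk ℓ P (ballClass d (r i)) +
              √(d * Real.logb 2 (16 * B * n * T / d) / (n * T)) *
                (8 * r i * X +
                  √8 * κ₂ * √(m + Real.log (Real.logb 2 (16 * B * n * T / d)))))}
        ≤ 2 * κ₁ * Real.exp (-m)) ∧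
    -- (b) nested dimensions
    (∀ (D : ℕ → ℕ) (r : ℕ → ℝ)
      (P : Measure ((ℕ → ℝ) × ℝ))
      (Z : ℕ → Ω → (ℕ → ℝ) × ℝ)
      (A : ℕ → ℝ → Ω → (ℕ → ℝ) → ℝ)
      (out : Ω → (ℕ → ℝ) → ℝ),
      0 < D 0 → StrictMono D → 0 < r 0 → Monotone r →
      IsClassificationSample μ P Z →
      (∀ i : ℕ, (i : ℕ∞) < K → ∀ f ∈ dimClass (D i) (r i),
        Integrable (fun z => ℓ (z.2 * f z.1)) P) →
      minRisk ℓ P (dimClass (D 0) (r 0)) ≤ B →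
      HasSampleSize K cost (fun i τ => n * τ / D i) →
      IsApproxERM K ℓ Z (fun i => dimClass (D i) (r i)) (vcPenalty D)
        (fun i τ => n * τ / D i) cost A →
      HasConcentration K μ P ℓ Z (fun i => dimClass (D i) (r i)) (vcPenalty D)
        (fun i τ => n * τ / D i) cost A κ₁ κ₂ →
      1 ≤ n * T → D 0 / B ≤ n * T →
      IsOutput K ℓ Z (vcPenalty D) (fun i τ => n * τ / D i) cost A κ₂ m B T out →
      totalCost K (vcPenalty D) (fun i τ => n * τ / D i) cost κ₂ m B T ≤ T ∧
      μ.real {ω | ¬ risk ℓ P (out ω) ≤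
          ⨅ i : {i : ℕ // (i : ℕ∞) < K},
            (minRisk ℓ P (dimClass (D i) (r i)) +
              √(D i * Real.logb 2 (16 * B * n * T / D 0) / (n * T)) *
                (4 * √(D i) +
                  √8 * κ₂ * √(m + Real.log (Real.logb 2 (16 * B * n * T / D 0)))))}
        ≤ 2 * κ₁ * Real.exp (-m)) := by
  refine ⟨?_, ?_⟩
  · intro d r X P Z A out hd hr0 hr hrt hX _ _ _ _ hmin hcost hA hconc hnT hnT' hout
    have hd' : (0 : ℝ) < d := by exact_mod_cast hd
    have hrpos : ∀ i, 0 < r i := fun i => hr0.trans_le (hr.monotone (Nat.zero_le i))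
    -- `a i` is twice the numerator of the penalty. The required `d ≤ a 0 ^ 2 * n T` then holds with
    -- a factor 4 to spare.
    have key := totalCost_le_and_measureReal_le (a := fun i => 4 * r i * X) (c := fun _ => (d : ℝ))
      hK hℓ0 hκ₁ hκ₂ hB hn hT hm (fun _ => hd') monotone_const
      (fun i => by have := hrpos i; positivity)
      (fun i j hij => by
        have := hr.monotone hij
        dsimp only
        gcongr)
      ((hrt.const_mul_atTop four_pos).atTop_mul_const hX)
      (fun i k _ => by
        simp only [rademacherPenalty]
        ring)
      (fun i => ⟨_, zero_mem_ballClass d (hrpos i).le⟩)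
      (fun i j hij => ballClass_mono d (hr.monotone hij)) hmin hcost hA hconc hnT
      (by
        rw [div_le_iff₀ (by positivity)] at hnT'
        have : 0 < n * T * (r 0 ^ 2 * X ^ 2) := by positivity
        linarith) hout
    simpa only [← mul_assoc, show (2 * 4 : ℝ) = 8 by norm_num] using key
  · intro D r P Z A out hD0 hD hr0 hr _ _ hmin hcost hA hconc hnT hnT' hout
    have hDpos : ∀ i, (0 : ℝ) < D i := fun i => by
      exact_mod_cast hD0.trans_le (hD.monotone (Nat.zero_le i))
    have hrpos : ∀ i, 0 < r i := fun i => hr0.trans_le (hr (Nat.zero_le i))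
    have hDmono : Monotone fun i => (D i : ℝ) := fun i j hij =>
      Nat.cast_le.2 (hD.monotone hij)
    -- Here `a 0 ^ 2 = 4 * D 0`, so the second budget condition follows from `1 ≤ n * T`. The
    -- penalties diverge because `D` is strictly increasing in `ℕ`.
    have key := totalCost_le_and_measureReal_le (a := fun i => 2 * √(D i)) (c := fun i => (D i : ℝ))
      hK hℓ0 hκ₁ hκ₂ hB hn hT hm hDpos hDmono
      (fun i => mul_pos two_pos (Real.sqrt_pos.2 (hDpos i)))
      (fun i j hij => mul_le_mul_of_nonneg_left (Real.sqrt_le_sqrt (hDmono hij)) zero_le_two)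
      ((Real.tendsto_sqrt_atTop.comp
        (tendsto_natCast_atTop_atTop.comp hD.tendsto_atTop)).const_mul_atTop two_pos)
      (fun i k _ => by
        simp only [vcPenalty]
        rw [Real.sqrt_div (hDpos i).le]
        ring)
      (fun i => ⟨_, zero_mem_dimClass (D i) (hrpos i).le⟩)
      (fun i j hij => dimClass_subset (hD.monotone hij) (hr hij)) hmin hcost hA hconc hnT'
      (by
        rw [mul_pow, Real.sq_sqrt (hDpos 0).le]
        nlinarith [hDpos 0]) hout
    simpa only [← mul_assoc, show (2 * 2 : ℝ) = 4 by norm_num] using key
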